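/- Let $(M^{(n_1)},g^{(n_1)})$ be a smooth Lorentzian manifold (signature $(-,+,\dots,+)$) of dimension $n_1\ge 1$ and $(M^{(n_2)},g^{(n_2)})$ a smooth nonempty Riemannian manifold of dimension $n_2\geq 1$, with $n=n_1+n_2\ge 4$, and let $M^{(n)}=M^{(n_1)}\times M^{(n_2)}$ carry the direct sum metric $g=g^{(n_1)}\oplus g^{(n_2)}$. The Weyl tensor of a manifold of dimension $k\ge 3$ is $$C_{abcd}=R_{abcd}-\tfrac{2}{k-2}\left(g_{a[c}R_{d]b}-g_{b[c}R_{d]a}\right)+\tfrac{2\mathcal R}{(k-1)(k-2)}\,g_{a[c}g_{d]b},$$ with $R_{ab}=R^c{}_{acb}$ and $\mathcal R=R^a{}_a$, and it is zero by convention if $k\le 2$. For a unit timelike vector $u$ at a point ($g(u,u)=-1$) let $\theta$ be the reflection $u\mapsto -u$, $x\mapsto x$ for $x\perp u$, acting on tensors; the manifold is *purely electric* (PE) with respect to $u$ at that point if $C$ equals its electric part $C_+=\tfrac12\,(C+\theta(C))$. Let $p=(p_1,p_2)\in M^{(n)}$ and let $U\in T_{p_1}M^{(n_1)}$ be a unit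 timelike vector, identified with its uplift to $T_pM^{(n)}$. Then: 1. $M^{(n)}$ is PE with respect to $U$ at $p$ if and only if $U$ is an eigenvector of the Ricci tensor $R^{(n_1)}_{ab}$ of $M^{(n_1)}$ and $M^{(n_1)}$ is PE with respect to $U$ at $p_1$. These two conditions together are equivalent to $$R^{(n_1)}_{UA}=0,\qquad C^{(n_1)}_{UABC}=0\qquad (A,B,C=2,\dots,n_1)$$ in any given orthonormal frame $\{U,m_2,\dots,m_{n_1}\}$ of $T_{p_1}M^{(n_1)}$. 2. If $M^{(n)}$ is PE with respect to $U$ at $p$, then $U$ is also an eigenvector of the Ricci tensor $R_{ab}$ of $M^{(n)}$ at $p$, i.e. $R_{Ui}=0$ ($i=2,\dots,n$) in every orthonormal frame $\{U,m_2,\dots,m_n\}$ of $T_pM^{(n)}$. Consequently, for a field $U$ of unit timelike vectors on $M^{(n_1)}$, the spacetime $M^{(n)}$ is PE with respect to $U$ at every point if and only if $U$ is everywhere an eigenvector of $R^{(n_1)}_{ab}$ and $M^{(n_1)}$ is everywhere PE with respect to $U$; and then $U$ is everywhere an eigenvector of $R_{ab}$. -/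

import Mathlib

set_option maxSynthPendingDepth 3

open scoped Manifold ContDiff Topology

noncomputable section

namespace PseudoRiemannian

/-! ### Curvature in a coordinate domain

`G` is a metric on (an open part of) a vector space `E`: to each point `x` it assigns a bilinear
form `G x`.  A continuous linear map `E →L[ℝ] E →L[ℝ] ℝ` is at the same time the lowering of
indices `E → E*`; its inverse is the raising of indices. -/

section Coordinates

variable {E : Type*} [NormedAddCommGroup E] [NormedSpace ℝ E]

/-- Christoffel symbols of the first kind, as a trilinear form:
`(v, w, z) ↦ ½ (∂_v G(w, z) + ∂_w G(v, z) - ∂_z G(v, w))`. -/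
def christoffelFirst (G : E → E →L[ℝ] E →L[ℝ] ℝ) (x : E) : E →L[ℝ] E →L[ℝ] E →L[ℝ] ℝ :=
  (1 / 2 : ℝ) • (fderiv ℝ G x + (fderiv ℝ G x).flip
    - (ContinuousLinearMap.flipₗᵢ ℝ E E ℝ).toContinuousLinearEquiv.toContinuousLinearMap.comp
        (fderiv ℝ G x).flip)

theorem christoffelFirst_apply (G : E → E →L[ℝ] E →L[ℝ] ℝ) (x v w z : E) :
    christoffelFirst G x v w z
      = (1 / 2 : ℝ) * (fderiv ℝ G x v w z + fderiv ℝ G x w v z - fderiv ℝ G x z v w) := rfl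

/-- Christoffel symbols of the Levi-Civita connection, `Γ(v, w) = ∇_v w` for constant fields. -/
def christoffel (G : E → E →L[ℝ] E →L[ℝ] ℝ) (x : E) : E →L[ℝ] E →L[ℝ] E :=
  (ContinuousLinearMap.compL ℝ E (E →L[ℝ] ℝ) E (G x).inverse).comp (christoffelFirst G x)

theorem christoffel_apply (G : E → E →L[ℝ] E →L[ℝ] ℝ) (x v w : E) :
    christoffel G x v w = (G x).inverse (christoffelFirst G x v w) := rfl

/-- The second covariant derivative of constant fields, without the part symmetric in `u, v`:
`(u, v, w) ↦ (∂_u Γ)(v, w) + Γ(u, Γ(v, w))`. -/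
def christoffelSecond (G : E → E →L[ℝ] E →L[ℝ] ℝ) (x : E) : E →L[ℝ] E →L[ℝ] E →L[ℝ] E :=
  fderiv ℝ (christoffel G) x
    + (ContinuousLinearMap.compL ℝ E E E).bilinearComp (christoffel G x) (christoffel G x)

/-- The Riemann curvature operator `(u, v, w) ↦ R(u, v) w = ∇_u ∇_v w - ∇_v ∇_u w`. -/
def curvatureOperator (G : E → E →L[ℝ] E →L[ℝ] ℝ) (x : E) : E →L[ℝ] E →L[ℝ] E →L[ℝ] E :=
  christoffelSecond G x - (christoffelSecond G x).flip

theorem curvatureOperator_apply (G : E → E →L[ℝ] E →L[ℝ] ℝ) (x u v w : E) :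
    curvatureOperator G x u v w
      = (fderiv ℝ (christoffel G) x u v w
            + christoffel G x u (christoffel G x v w))
          - (fderiv ℝ (christoffel G) x v u w
            + christoffel G x v (christoffel G x u w)) := rfl

end Coordinates

/-! ### Algebra at one point -/

section Algebra

variable {E : Type*} [NormedAddCommGroup E] [NormedSpace ℝ E]

/-- The Ricci contraction `R_{ab} = R^c_{acb}` of a curvature operator `R(u, v) w`:
`Ric(y, z)` is the trace of `u ↦ R(u, z) y`. -/
def ricciOf (R : E →L[ℝ] E →L[ℝ] E →L[ℝ] E) : E →ₗ[ℝ] E →ₗ[ℝ] ℝ :=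
  LinearMap.mk₂ ℝ
    (fun y z => LinearMap.trace ℝ E (((R.flip z).flip y : E →L[ℝ] E) : E →ₗ[ℝ] E))
    (by intro y y' z; simp) (by intro c y z; simp) (by intro y z z'; simp) (by intro c y z; simp)

theorem ricciOf_apply (R : E →L[ℝ] E →L[ℝ] E →L[ℝ] E) (y z : E) :
    ricciOf R y z
      = LinearMap.trace ℝ E (((R.flip z).flip y : E →L[ℝ] E) : E →ₗ[ℝ] E) := rfl

/-- The metric trace `g^{ab} S_{ab}` of a bilinear form `S`: the trace of the endomorphism
obtained by raising an index of `S`. -/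
def metricTrace [FiniteDimensional ℝ E] (g : E →L[ℝ] E →L[ℝ] ℝ) (S : E →ₗ[ℝ] E →ₗ[ℝ] ℝ) : ℝ :=
  LinearMap.trace ℝ E
    ((g.inverse : (E →L[ℝ] ℝ) →ₗ[ℝ] E) ∘ₗ
      ((LinearMap.toContinuousLinearMap : (E →ₗ[ℝ] ℝ) ≃ₗ[ℝ] (E →L[ℝ] ℝ)) :
        (E →ₗ[ℝ] ℝ) →ₗ[ℝ] (E →L[ℝ] ℝ)) ∘ₗ S)

/-- The Weyl tensor `C_{abcd}` obtained from a metric `g` and the curvature operator `R` on a space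
of dimension `n`, where `R_{abcd} = g(a, R(c, d) b)`:
`C_{abcd} = R_{abcd} - 2/(n-2) (g_{a[c} R_{d]b} - g_{b[c} R_{d]a})
  + 2 ℛ/((n-1)(n-2)) g_{a[c} g_{d]b}`.
In dimensions `n ≤ 2`, where the formula makes no sense, the Weyl tensor is zero by convention. -/
def weylOf [FiniteDimensional ℝ E] (g : E →L[ℝ] E →L[ℝ] ℝ) (R : E →L[ℝ] E →L[ℝ] E →L[ℝ] E)
    (a b c d : E) : ℝ :=
  if Module.finrank ℝ E ≤ 2 then 0
  else
    g a (R c d b)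
      - 1 / ((Module.finrank ℝ E : ℝ) - 2) *
        ((g a c * ricciOf R d b - g a d * ricciOf R c b)
          - (g b c * ricciOf R d a - g b d * ricciOf R c a))
      + metricTrace g (ricciOf R)
          / (((Module.finrank ℝ E : ℝ) - 1) * ((Module.finrank ℝ E : ℝ) - 2)) *
        (g a c * g d b - g a d * g c b)

end Algebra

/-! ### Pseudo-Riemannian manifolds -/

section Manifold

variable {E : Type*} [NormedAddCommGroup E] [NormedSpace ℝ E]
  {H : Type*} [TopologicalSpace H] {I : ModelWithCorners ℝ E H}
  {M : Type*} [TopologicalSpace M] [ChartedSpace H M]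

/-- The expression of a field `val` of bilinear forms in the chart at `p`: its pull-back under the
inverse of the chart. -/
def inChart (val : ∀ x : M, TangentSpace I x →L[ℝ] TangentSpace I x →L[ℝ] ℝ) (p : M) (x : E) :
    E →L[ℝ] E →L[ℝ] ℝ :=
  ContinuousLinearMap.bilinearComp (E := E) (F := E) (E' := E) (F' := E)
    (val ((extChartAt I p).symm x)) (mfderiv 𝓘(ℝ, E) I (extChartAt I p).symm x)
    (mfderiv 𝓘(ℝ, E) I (extChartAt I p).symm x)

end Manifold

/-- A smooth pseudo-Riemannian metric on a manifold without boundary: a field of symmetric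
nondegenerate bilinear forms on the tangent spaces, with smooth components in charts. -/
structure Metric {E : Type*} [NormedAddCommGroup E] [NormedSpace ℝ E]
    {H : Type*} [TopologicalSpace H] (I : ModelWithCorners ℝ E H) [I.Boundaryless]
    (M : Type*) [TopologicalSpace M] [ChartedSpace H M] [IsManifold I ∞ M] where
  val (x : M) : TangentSpace I x →L[ℝ] TangentSpace I x →L[ℝ] ℝ
  symm (x : M) (v w : TangentSpace I x) : val x v w = val x w v
  nondegenerate (x : M) (v : TangentSpace I x) (hv : ∀ w, val x v w = 0) : v = 0
  smooth (p : M) : ContDiffOn ℝ ∞ (inChart val p) (extChartAt I p).target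

namespace Metric

section Basic

variable {E : Type*} [NormedAddCommGroup E] [NormedSpace ℝ E]
  {H : Type*} [TopologicalSpace H] {I : ModelWithCorners ℝ E H} [I.Boundaryless]
  {M : Type*} [TopologicalSpace M] [ChartedSpace H M] [IsManifold I ∞ M]

/-- Signature `(-, +, …, +)`: each tangent space has a timelike vector with positive definite
orthogonal complement. -/
def IsLorentzian (g : Metric I M) : Prop :=
  ∀ x : M, ∃ u : TangentSpace I x, g.val x u u < 0 ∧
    ∀ v : TangentSpace I x, g.val x u v = 0 → v ≠ 0 → 0 < g.val x v v

/-- The metric is positive definite. -/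
def IsRiemannian (g : Metric I M) : Prop :=
  ∀ (x : M) (v : TangentSpace I x), v ≠ 0 → 0 < g.val x v v

/-- `u` is a unit timelike vector at `x`. -/
def IsUnitTimelike (g : Metric I M) (x : M) (u : TangentSpace I x) : Prop :=
  g.val x u u = -1

/-- `m` completes the unit timelike vector `u` to an orthonormal frame of the tangent space. -/
def IsFrame (g : Metric I M) (x : M) (u : TangentSpace I x) {k : ℕ} (m : Fin k → TangentSpace I x) :
    Prop :=
  k + 1 = Module.finrank ℝ E ∧ g.val x u u = -1 ∧ (∀ i, g.val x u (m i) = 0) ∧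
    ∀ i j, g.val x (m i) (m j) = if i = j then 1 else 0

/-- The Riemann curvature operator at `p`, computed in the chart at `p`. (The tangent space at `p`
is identified with the model space by that same chart.) -/
def curvature (g : Metric I M) (p : M) :
    TangentSpace I p →L[ℝ] TangentSpace I p →L[ℝ] TangentSpace I p →L[ℝ] TangentSpace I p :=
  curvatureOperator (E := E) (inChart g.val p) (extChartAt I p p)

/-- The Ricci tensor at `p`. -/
def ricci (g : Metric I M) (p : M) : TangentSpace I p →ₗ[ℝ] TangentSpace I p →ₗ[ℝ] ℝ :=
  ricciOf (E := E) (g.curvature p)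

/-- The Weyl tensor `C_{abcd}` at `p`. -/
def weyl [FiniteDimensional ℝ E] (g : Metric I M) (p : M) (a b c d : TangentSpace I p) : ℝ :=
  weylOf (E := E) (g.val p) (g.curvature p) a b c d

/-- The Cartan involution (time reversal) at `p` fixed by a unit timelike vector `u`: the
reflection `θ^a_b = δ^a_b + 2 u^a u_b`, which maps `u` to `-u` and is the identity on `u^⊥`. -/
def cartan (g : Metric I M) (p : M) (u v : TangentSpace I p) : TangentSpace I p :=
  v + (2 * g.val p u v) • u

/-- The electric part `C_+ = ½ (C + θ(C))` of the Weyl tensor at `p` with respect to `u`. -/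
def weylElectric [FiniteDimensional ℝ E] (g : Metric I M) (p : M) (u a b c d : TangentSpace I p) :
    ℝ :=
  1 / 2 * (g.weyl p a b c d
    + g.weyl p (g.cartan p u a) (g.cartan p u b) (g.cartan p u c) (g.cartan p u d))

/-- The Weyl tensor at `p` is purely electric with respect to `u`: `C = C_+`. -/
def IsPE [FiniteDimensional ℝ E] (g : Metric I M) (p : M) (u : TangentSpace I p) : Prop :=
  ∀ a b c d : TangentSpace I p, g.weyl p a b c d = g.weylElectric p u a b c d

/-- The (nonzero) vector `u` is an eigenvector of the Ricci tensor at `p`: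
`R_{ab} u^b = lam g_{ab} u^b`. -/
def IsRicciEigenvector (g : Metric I M) (p : M) (u : TangentSpace I p) : Prop :=
  u ≠ 0 ∧ ∃ lam : ℝ, ∀ v : TangentSpace I p, g.ricci p v u = lam * g.val p v u

end Basic

section Product

variable {E₁ : Type*} [NormedAddCommGroup E₁] [NormedSpace ℝ E₁]
  {H₁ : Type*} [TopologicalSpace H₁] {I₁ : ModelWithCorners ℝ E₁ H₁} [I₁.Boundaryless]
  {M₁ : Type*} [TopologicalSpace M₁] [ChartedSpace H₁ M₁] [IsManifold I₁ ∞ M₁]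
  {E₂ : Type*} [NormedAddCommGroup E₂] [NormedSpace ℝ E₂]
  {H₂ : Type*} [TopologicalSpace H₂] {I₂ : ModelWithCorners ℝ E₂ H₂} [I₂.Boundaryless]
  {M₂ : Type*} [TopologicalSpace M₂] [ChartedSpace H₂ M₂] [IsManifold I₂ ∞ M₂]

/-- The bilinear form `((v₁, v₂), (w₁, w₂)) ↦ g₁(v₁, w₁) + g₂(v₂, w₂)` on the tangent space
`T_p(M₁ × M₂) = T_{p.1} M₁ × T_{p.2} M₂`. -/
def prodVal (g₁ : Metric I₁ M₁) (g₂ : Metric I₂ M₂) (p : M₁ × M₂) :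
    TangentSpace (I₁.prod I₂) p →L[ℝ] TangentSpace (I₁.prod I₂) p →L[ℝ] ℝ :=
  ContinuousLinearMap.bilinearComp (E := E₁) (F := E₁) (E' := E₁ × E₂) (F' := E₁ × E₂) (g₁.val p.1)
      (ContinuousLinearMap.fst ℝ E₁ E₂) (ContinuousLinearMap.fst ℝ E₁ E₂)
    + ContinuousLinearMap.bilinearComp (E := E₂) (F := E₂) (E' := E₁ × E₂) (F' := E₁ × E₂)
      (g₂.val p.2) (ContinuousLinearMap.snd ℝ E₁ E₂) (ContinuousLinearMap.snd ℝ E₁ E₂)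

theorem prodVal_apply (g₁ : Metric I₁ M₁) (g₂ : Metric I₂ M₂) (p : M₁ × M₂)
    (v w : TangentSpace (I₁.prod I₂) p) :
    prodVal g₁ g₂ p v w = g₁.val p.1 v.1 w.1 + g₂.val p.2 v.2 w.2 := rfl

/-- The inverse of the product chart has block-diagonal derivative. -/
theorem mfderiv_extChartAt_symm_prod (p : M₁ × M₂) (x v : E₁ × E₂)
    (hx : x ∈ (extChartAt (I₁.prod I₂) p).target) :
    (mfderiv 𝓘(ℝ, E₁ × E₂) (I₁.prod I₂) (extChartAt (I₁.prod I₂) p).symm x v : E₁ × E₂)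
      = (mfderiv 𝓘(ℝ, E₁) I₁ (extChartAt I₁ p.1).symm x.1 v.1,
          mfderiv 𝓘(ℝ, E₂) I₂ (extChartAt I₂ p.2).symm x.2 v.2) := by
  rw [extChartAt_prod] at hx
  have e1 : IsManifold I₁ 1 M₁ := IsManifold.of_le (n := ∞) (by simp)
  have e2 : IsManifold I₂ 1 M₂ := IsManifold.of_le (n := ∞) (by simp)
  have d1 := mdifferentiableWithinAt_extChartAt_symm (I := I₁) (x := p.1) hx.1
  have d2 := mdifferentiableWithinAt_extChartAt_symm (I := I₂) (x := p.2) hx.2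
  rw [ModelWithCorners.range_eq_univ, mdifferentiableWithinAt_univ] at d1 d2
  have f1 : HasMFDerivAt 𝓘(ℝ, E₁ × E₂) 𝓘(ℝ, E₁) (Prod.fst : E₁ × E₂ → E₁) x
      (ContinuousLinearMap.fst ℝ E₁ E₂) := hasFDerivAt_fst.hasMFDerivAt
  have f2 : HasMFDerivAt 𝓘(ℝ, E₁ × E₂) 𝓘(ℝ, E₂) (Prod.snd : E₁ × E₂ → E₂) x
      (ContinuousLinearMap.snd ℝ E₁ E₂) := hasFDerivAt_snd.hasMFDerivAt
  have h := (HasMFDerivAt.comp x d1.hasMFDerivAt f1).prodMk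
    (HasMFDerivAt.comp x d2.hasMFDerivAt f2)
  have hf : ((extChartAt (I₁.prod I₂) p).symm : E₁ × E₂ → M₁ × M₂)
      = fun y => (((extChartAt I₁ p.1).symm ∘ Prod.fst) y, ((extChartAt I₂ p.2).symm ∘ Prod.snd) y) := by
    rw [extChartAt_prod]
    rfl
  rw [hf, h.mfderiv]
  rfl

/-- In the product chart, the product field is the direct sum of the chart expressions. -/
theorem inChart_prodVal (g₁ : Metric I₁ M₁) (g₂ : Metric I₂ M₂) (p : M₁ × M₂) (x : E₁ × E₂)
    (hx : x ∈ (extChartAt (I₁.prod I₂) p).target) :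
    inChart (prodVal g₁ g₂) p x
      = (inChart g₁.val p.1 x.1).bilinearComp
          (ContinuousLinearMap.fst ℝ E₁ E₂) (ContinuousLinearMap.fst ℝ E₁ E₂)
        + (inChart g₂.val p.2 x.2).bilinearComp
          (ContinuousLinearMap.snd ℝ E₁ E₂) (ContinuousLinearMap.snd ℝ E₁ E₂) := by
  refine ContinuousLinearMap.ext fun v => ContinuousLinearMap.ext fun w => ?_
  have hq : ((extChartAt (I₁.prod I₂) p).symm x : M₁ × M₂)
      = ((extChartAt I₁ p.1).symm x.1, (extChartAt I₂ p.2).symm x.2) := by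
    rw [extChartAt_prod]
    rfl
  have key : ∀ (q q' : M₁ × M₂) (a b a' b' : E₁ × E₂), q = q' → a = a' → b = b' →
      (prodVal g₁ g₂ q a b : ℝ) = g₁.val q'.1 a'.1 b'.1 + g₂.val q'.2 a'.2 b'.2 := by
    rintro q _ a b _ _ rfl rfl rfl
    rfl
  exact key _ _ _ _ _ _ hq (mfderiv_extChartAt_symm_prod p x v hx)
    (mfderiv_extChartAt_symm_prod p x w hx)

/-- Pulling back bilinear forms under a fixed linear map preserves smoothness. -/
theorem contDiffOn_bilinearComp {E F : Type*} [NormedAddCommGroup E] [NormedSpace ℝ E]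
    [NormedAddCommGroup F] [NormedSpace ℝ F] {f : F → E →L[ℝ] E →L[ℝ] ℝ} {s : Set F}
    (hf : ContDiffOn ℝ ∞ f s) (A : F →L[ℝ] E) :
    ContDiffOn ℝ ∞ (fun x => (f x).bilinearComp A A) s := by
  have h1 : ContDiffOn ℝ ∞ (fun x => ((f x).comp A).flip) s :=
    (ContinuousLinearMap.flipₗᵢ ℝ F E ℝ).contDiff.comp_contDiffOn (hf.clm_comp contDiffOn_const)
  exact (ContinuousLinearMap.flipₗᵢ ℝ F F ℝ).contDiff.comp_contDiffOn
    (h1.clm_comp contDiffOn_const)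

/-- The direct sum metric on the product manifold. -/
def prod (g₁ : Metric I₁ M₁) (g₂ : Metric I₂ M₂) : Metric (I₁.prod I₂) (M₁ × M₂) where
  val := prodVal g₁ g₂
  symm p v w :=
    congrArg₂ (· + ·) (g₁.symm p.1 v.1 w.1) (g₂.symm p.2 v.2 w.2)
  nondegenerate p v hv := by
    have h1 : v.1 = 0 := g₁.nondegenerate p.1 v.1 fun w => by
      have h : g₁.val p.1 v.1 w + g₂.val p.2 v.2 0 = 0 := hv ((w, 0) : E₁ × E₂)
      rwa [map_zero, add_zero] at h
    have h2 : v.2 = 0 := g₂.nondegenerate p.2 v.2 fun w => by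
      have h : g₁.val p.1 v.1 0 + g₂.val p.2 v.2 w = 0 := hv ((0, w) : E₁ × E₂)
      rwa [map_zero, zero_add] at h
    exact Prod.ext h1 h2
  smooth p := by
    have ht : ∀ x ∈ (extChartAt (I₁.prod I₂) p).target,
        x.1 ∈ (extChartAt I₁ p.1).target ∧ x.2 ∈ (extChartAt I₂ p.2).target := by
      intro x hx
      rw [extChartAt_prod] at hx
      exact ⟨hx.1, hx.2⟩
    have h1 := contDiffOn_bilinearComp ((g₁.smooth p.1).comp contDiffOn_fst fun x hx => (ht x hx).1)
      (ContinuousLinearMap.fst ℝ E₁ E₂)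
    have h2 := contDiffOn_bilinearComp ((g₂.smooth p.2).comp contDiffOn_snd fun x hx => (ht x hx).2)
      (ContinuousLinearMap.snd ℝ E₁ E₂)
    exact (h1.add h2).congr fun x hx => inChart_prodVal g₁ g₂ p x hx

/-- The uplift to `M₁ × M₂` of a vector tangent to the first factor. -/
def liftLeft (p : M₁ × M₂) (u : TangentSpace I₁ p.1) : TangentSpace (I₁.prod I₂) p :=
  ((u, 0) : E₁ × E₂)

end Product

end Metric

end PseudoRiemannian

end

/-! Write θ for the reflection determined by u. Since C = ½(C + θ(C)) means C = θ(C), and θ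
multiplies a component by -1 for each entry u, purely electric means that components with an odd
number of entries u vanish. Antisymmetry kills those with three, so the condition is C(u, x, y, z) =
0 for x, y, z ⊥ u (`reflection_invariant_iff`). Being a Ricci eigenvector likewise means Ric(x, u) =
0 for x ⊥ u (`ricci_eigenvector_iff`).

For y, z ⊥ u the scalar curvature term drops out (`weylOf_of_orthogonal`): C(u, x, y, z) = g(u, R(y,
z)x) + (g(x, y) Ric(z, u) - g(x, z) Ric(y, u))/(n - 2). The curvature of a direct sum is block
diagonal (`curvature_prod`), so with u in the first factor, g(u, R(y, z)x) and Ric(·, u) see only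
first components. Taking x = y = e in the second factor isolates g₂(e, e) Ric₁(z, u)/(n - 2), which
forces Ric₁(z, u) = 0. Once these Ricci terms vanish, the magnetic components of the product and of
the first factor are the same number g₁(u, R₁(y, z)x), whatever the dimension
(`weylOf_sumForm_iff`). If n₁ ≤ 2, that number is zero anyway.

The algebra needs the symmetries of the Riemann tensor and the symmetry of Ricci, which are derived
from the coordinate definition of curvature. -/

noncomputable section

namespace PseudoRiemannian

/-! ### Symmetries of the Riemann tensor in coordinates -/

section CoordinateCurvature

variable {E : Type*} [NormedAddCommGroup E] [NormedSpace ℝ E]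

/-- `G` is a smooth pseudo-Riemannian metric near `x`. -/
structure IsMetricNear (G : E → E →L[ℝ] E →L[ℝ] ℝ) (x : E) : Prop where
  eventually_contDiffAt : ∀ᶠ y in 𝓝 x, ContDiffAt ℝ ∞ G y
  symm : ∀ᶠ y in 𝓝 x, ∀ v w, G y v w = G y w v
  isInvertible : ∀ᶠ y in 𝓝 x, (G y).IsInvertible

/-- The pointwise algebraic symmetries of the curvature operator of a Levi-Civita connection. -/
structure IsCurvatureLike (g : E →L[ℝ] E →L[ℝ] ℝ) (R : E →L[ℝ] E →L[ℝ] E →L[ℝ] E) : Prop where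
  symm : ∀ v w, g v w = g w v
  skew : ∀ u v w, R u v w = -R v u w
  bianchi : ∀ u v w, R u v w + R v w u + R w u v = 0
  skew_adjoint : ∀ u v w z, g z (R u v w) = -g w (R u v z)

/-- The classical octahedron argument: four Bianchi identities, one for each choice of the
distinguished entry, combined with antisymmetry in both pairs. -/
theorem IsCurvatureLike.pair_symm {g : E →L[ℝ] E →L[ℝ] ℝ} {R : E →L[ℝ] E →L[ℝ] E →L[ℝ] E}
    (h : IsCurvatureLike g R) (a b c d : E) : g a (R c d b) = g c (R a b d) := by
  have bi (z u v w : E) : g z (R u v w) + g z (R v w u) + g z (R w u v) = 0 := by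
    rw [← map_add, ← map_add, h.bianchi, map_zero]
  have sk (z u v w : E) : g z (R u v w) = -g z (R v u w) := by rw [h.skew, map_neg]
  linarith [bi a b c d, bi b c d a, bi c d a b, bi d a b c, sk a b c d, sk a c d b, sk a d b c,
    sk b c d a, sk b d a c, sk b a c d, sk c d a b, sk c a b d, sk c b d a, sk d a b c,
    sk d b c a, sk d c a b, h.skew_adjoint b c d a, h.skew_adjoint c d b a,
    h.skew_adjoint d b c a, h.skew_adjoint d a c b, h.skew_adjoint a c d b,
    h.skew_adjoint a b d c, h.skew_adjoint a b c d, h.skew_adjoint b c a d,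
    h.skew_adjoint c a b d]

theorem fderiv_apply₂ {F : Type*} [NormedAddCommGroup F] [NormedSpace ℝ F]
    {G : E → E →L[ℝ] E →L[ℝ] F} {x : E} (hG : DifferentiableAt ℝ G x) (u v w : E) :
    fderiv ℝ (fun y => G y v w) x u = fderiv ℝ G x u v w := by
  have h := (hG.hasFDerivAt.clm_apply (hasFDerivAt_const v x)).clm_apply (hasFDerivAt_const w x)
  rw [h.fderiv]
  simp

variable {G : E → E →L[ℝ] E →L[ℝ] ℝ} {x : E}

namespace IsMetricNear

/-- Lets pointwise identities for `christoffel` hold on a neighbourhood, so that they can be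
differentiated. -/
theorem eventually (h : IsMetricNear G x) : ∀ᶠ y in 𝓝 x, IsMetricNear G y := by
  filter_upwards [h.eventually_contDiffAt.eventually_nhds, h.symm.eventually_nhds,
    h.isInvertible.eventually_nhds] with y h1 h2 h3 using ⟨h1, h2, h3⟩

theorem contDiffAt (h : IsMetricNear G x) : ContDiffAt ℝ ∞ G x :=
  h.eventually_contDiffAt.self_of_nhds

theorem differentiableAt (h : IsMetricNear G x) : DifferentiableAt ℝ G x :=
  h.contDiffAt.differentiableAt (by simp)

theorem contDiffAt_fderiv (h : IsMetricNear G x) : ContDiffAt ℝ ∞ (fderiv ℝ G) x :=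
  h.contDiffAt.fderiv_right (by simp)

theorem fderiv_symm (h : IsMetricNear G x) (u v w : E) :
    fderiv ℝ G x u v w = fderiv ℝ G x u w v := by
  rw [← fderiv_apply₂ h.differentiableAt, ← fderiv_apply₂ h.differentiableAt]
  have : (fun y => G y v w) =ᶠ[𝓝 x] fun y => G y w v := h.symm.mono fun y hy => hy v w
  rw [this.fderiv_eq]

theorem contDiffAt_christoffelFirst (h : IsMetricNear G x) :
    ContDiffAt ℝ ∞ (christoffelFirst G) x := by
  have h1 := h.contDiffAt_fderiv
  have h2 : ContDiffAt ℝ ∞ (fun y => (fderiv ℝ G y).flip) x :=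
    (ContinuousLinearMap.flipₗᵢ ℝ E E (E →L[ℝ] ℝ)).contDiff.contDiffAt.comp x h1
  exact ((h1.add h2).sub (contDiffAt_const.clm_comp h2)).const_smul _

theorem contDiffAt_christoffel [CompleteSpace E] (h : IsMetricNear G x) :
    ContDiffAt ℝ ∞ (christoffel G) x := by
  obtain ⟨e, he⟩ := h.isInvertible.self_of_nhds
  have h1 : ContDiffAt ℝ ∞ (fun y => (G y).inverse) x := by
    have := contDiffAt_map_inverse (n := ∞) e
    rw [he] at this
    exact this.comp x h.contDiffAt
  have h2 := (ContinuousLinearMap.compL ℝ E (E →L[ℝ] ℝ) E).contDiff.contDiffAt.comp x h1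
  exact h2.clm_comp h.contDiffAt_christoffelFirst

theorem apply_christoffel (h : IsMetricNear G x) (v w z : E) :
    G x (christoffel G x v w) z = christoffelFirst G x v w z := by
  rw [christoffel_apply, h.isInvertible.self_of_nhds.self_apply_inverse]

theorem christoffelFirst_symm (h : IsMetricNear G x) (v w z : E) :
    christoffelFirst G x v w z = christoffelFirst G x w v z := by
  rw [christoffelFirst_apply, christoffelFirst_apply, h.fderiv_symm z v w]
  ring

theorem christoffel_symm (h : IsMetricNear G x) (v w : E) :
    christoffel G x v w = christoffel G x w v := by
  rw [christoffel_apply, christoffel_apply]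
  congr 1
  ext z
  exact h.christoffelFirst_symm v w z

theorem fderiv_christoffel_symm [CompleteSpace E] (h : IsMetricNear G x) (u v w : E) :
    fderiv ℝ (christoffel G) x u v w = fderiv ℝ (christoffel G) x u w v := by
  have hd : DifferentiableAt ℝ (christoffel G) x := h.contDiffAt_christoffel.differentiableAt (by simp)
  rw [← fderiv_apply₂ hd, ← fderiv_apply₂ hd]
  have : (fun y => christoffel G y v w) =ᶠ[𝓝 x] fun y => christoffel G y w v :=
    h.eventually.mono fun y hy => hy.christoffel_symm v w
  rw [this.fderiv_eq]

/-- The connection is metric. -/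
theorem fderiv_apply (h : IsMetricNear G x) (u v w : E) :
    fderiv ℝ G x u v w = christoffelFirst G x u v w + christoffelFirst G x u w v := by
  rw [christoffelFirst_apply, christoffelFirst_apply, h.fderiv_symm u w v]
  ring

/-- The derivative of `G(Γ(v, w), z) = Γ(v, w, z)` in the direction `u`. -/
theorem apply_fderiv_christoffel [CompleteSpace E] (h : IsMetricNear G x) (u v w z : E) :
    G x (fderiv ℝ (christoffel G) x u v w) z
      = fderiv ℝ (fun y => christoffelFirst G y v w z) x u
        - fderiv ℝ G x u (christoffel G x v w) z := by
  have hd : DifferentiableAt ℝ (christoffel G) x := h.contDiffAt_christoffel.differentiableAt (by simp)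
  have h1 := (h.differentiableAt.hasFDerivAt.clm_apply
    ((hd.hasFDerivAt.clm_apply (hasFDerivAt_const v x)).clm_apply
      (hasFDerivAt_const w x))).clm_apply (hasFDerivAt_const z x)
  have h2 : (fun y => christoffelFirst G y v w z) =ᶠ[𝓝 x] fun y => G y (christoffel G y v w) z :=
    h.eventually.mono fun y hy => (hy.apply_christoffel v w z).symm
  rw [h2.fderiv_eq, h1.fderiv]
  simp

/-- Derivative of the metric compatibility `fderiv_apply`; the right side is symmetric in u and v by
Schwarz. -/
theorem fderiv_christoffelFirst_add (h : IsMetricNear G x) (u v w z : E) :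
    fderiv ℝ (fun y => christoffelFirst G y v w z) x u
      + fderiv ℝ (fun y => christoffelFirst G y v z w) x u
      = fderiv ℝ (fderiv ℝ G) x u v w z := by
  have hd (v w z : E) : DifferentiableAt ℝ (fun y => christoffelFirst G y v w z) x := by
    have h1 : DifferentiableAt ℝ (christoffelFirst G) x :=
      h.contDiffAt_christoffelFirst.differentiableAt (by simp)
    fun_prop
  have h2 : DifferentiableAt ℝ (fderiv ℝ G) x := h.contDiffAt_fderiv.differentiableAt (by simp)
  have h3 : (fun y => christoffelFirst G y v w z + christoffelFirst G y v z w)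
      =ᶠ[𝓝 x] fun y => fderiv ℝ G y v w z :=
    h.eventually.mono fun y hy => (hy.fderiv_apply v w z).symm
  have h4 := ((h2.hasFDerivAt.clm_apply (hasFDerivAt_const v x)).clm_apply
    (hasFDerivAt_const w x)).clm_apply (hasFDerivAt_const z x)
  rw [← add_apply, ← fderiv_fun_add (hd v w z) (hd v z w), h3.fderiv_eq, h4.fderiv]
  simp

/-- The Bianchi identity comes from vanishing torsion. Skew-adjointness comes from metric
compatibility together with equality of mixed second derivatives of G. -/
theorem isCurvatureLike [CompleteSpace E] (h : IsMetricNear G x) :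
    IsCurvatureLike (G x) (curvatureOperator G x) where
  symm := h.symm.self_of_nhds
  skew u v w := by simp only [curvatureOperator_apply]; abel
  bianchi u v w := by
    simp only [curvatureOperator_apply]
    rw [h.fderiv_christoffel_symm u v w, h.fderiv_christoffel_symm v w u,
      h.fderiv_christoffel_symm w u v, h.christoffel_symm v w, h.christoffel_symm w u,
      h.christoffel_symm u v]
    abel
  skew_adjoint u v w z := by
    have hs := h.symm.self_of_nhds
    have hsec : fderiv ℝ (fderiv ℝ G) x u v = fderiv ℝ (fderiv ℝ G) x v u :=
      ((contDiffAt_infty.1 h.contDiffAt 2).isSymmSndFDerivAt (by simp)) u v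
    -- Lowered curvature: the terms Γ(u, Γ(v, w), z) cancel against part of the derivative of G. The
    -- quadratic terms left are antisymmetric in w, z, and symmetrizing the derivative terms gives
    -- ∂_u∂_v G - ∂_v∂_u G.
    have key (u v w z : E) : G x z (curvatureOperator G x u v w)
        = fderiv ℝ (fun y => christoffelFirst G y v w z) x u
          - fderiv ℝ (fun y => christoffelFirst G y u w z) x v
          - G x (christoffel G x u z) (christoffel G x v w)
          + G x (christoffel G x v z) (christoffel G x u w) := by
      rw [hs, curvatureOperator_apply]
      simp only [map_sub, map_add, sub_apply, add_apply]
      rw [h.apply_fderiv_christoffel, h.apply_fderiv_christoffel, h.apply_christoffel,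
        h.apply_christoffel, h.apply_christoffel, h.apply_christoffel, h.fderiv_apply,
        h.fderiv_apply]
      ring
    have h1 := h.fderiv_christoffelFirst_add u v w z
    have h2 := h.fderiv_christoffelFirst_add v u w z
    rw [hsec] at h1
    rw [key, key]
    linarith [hs (christoffel G x u z) (christoffel G x v w),
      hs (christoffel G x v z) (christoffel G x u w)]

end IsMetricNear

end CoordinateCurvature

/-! ### Curvature of a direct sum metric -/

section DirectSum

variable {E₁ : Type*} [NormedAddCommGroup E₁] [NormedSpace ℝ E₁]
  {E₂ : Type*} [NormedAddCommGroup E₂] [NormedSpace ℝ E₂]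

/-- The direct sum of two bilinear forms. -/
def sumForm (b₁ : E₁ →L[ℝ] E₁ →L[ℝ] ℝ) (b₂ : E₂ →L[ℝ] E₂ →L[ℝ] ℝ) :
    E₁ × E₂ →L[ℝ] E₁ × E₂ →L[ℝ] ℝ :=
  b₁.bilinearComp (ContinuousLinearMap.fst ℝ E₁ E₂) (ContinuousLinearMap.fst ℝ E₁ E₂)
    + b₂.bilinearComp (ContinuousLinearMap.snd ℝ E₁ E₂) (ContinuousLinearMap.snd ℝ E₁ E₂)

theorem sumForm_apply (b₁ : E₁ →L[ℝ] E₁ →L[ℝ] ℝ) (b₂ : E₂ →L[ℝ] E₂ →L[ℝ] ℝ) (v w : E₁ × E₂) :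
    sumForm b₁ b₂ v w = b₁ v.1 w.1 + b₂ v.2 w.2 := rfl

variable {G₁ : E₁ → E₁ →L[ℝ] E₁ →L[ℝ] ℝ} {G₂ : E₂ → E₂ →L[ℝ] E₂ →L[ℝ] ℝ}
  {G : E₁ × E₂ → E₁ × E₂ →L[ℝ] E₁ × E₂ →L[ℝ] ℝ} {x : E₁ × E₂}

theorem fderiv_sumForm (h : IsMetricNear G x) (h₁ : IsMetricNear G₁ x.1)
    (h₂ : IsMetricNear G₂ x.2) (hG : ∀ᶠ y in 𝓝 x, G y = sumForm (G₁ y.1) (G₂ y.2))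
    (u v w : E₁ × E₂) :
    fderiv ℝ G x u v w = fderiv ℝ G₁ x.1 u.1 v.1 w.1 + fderiv ℝ G₂ x.2 u.2 v.2 w.2 := by
  rw [← fderiv_apply₂ h.differentiableAt]
  have h3 : (fun y => G y v w) =ᶠ[𝓝 x] fun y => G₁ y.1 v.1 w.1 + G₂ y.2 v.2 w.2 := by
    filter_upwards [hG] with y hy
    rw [hy, sumForm_apply]
  have d1 := (((h₁.differentiableAt.hasFDerivAt).comp x hasFDerivAt_fst).clm_apply
    (hasFDerivAt_const v.1 x)).clm_apply (hasFDerivAt_const w.1 x)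
  have d2 := (((h₂.differentiableAt.hasFDerivAt).comp x hasFDerivAt_snd).clm_apply
    (hasFDerivAt_const v.2 x)).clm_apply (hasFDerivAt_const w.2 x)
  rw [h3.fderiv_eq]
  erw [(d1.add d2).fderiv]
  simp

/-- By invertibility of G it suffices to compare after lowering the index, where everything is a sum
of two blocks. -/
theorem christoffel_sumForm (h : IsMetricNear G x) (h₁ : IsMetricNear G₁ x.1)
    (h₂ : IsMetricNear G₂ x.2) (hG : ∀ᶠ y in 𝓝 x, G y = sumForm (G₁ y.1) (G₂ y.2))
    (v w : E₁ × E₂) :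
    christoffel G x v w = (christoffel G₁ x.1 v.1 w.1, christoffel G₂ x.2 v.2 w.2) := by
  rw [christoffel_apply, h.isInvertible.self_of_nhds.inverse_apply_eq]
  refine ContinuousLinearMap.ext fun z => ?_
  rw [hG.self_of_nhds, sumForm_apply, h₁.apply_christoffel, h₂.apply_christoffel]
  simp only [christoffelFirst_apply, fderiv_sumForm h h₁ h₂ hG]
  ring

theorem fderiv_christoffel_sumForm [CompleteSpace E₁] [CompleteSpace E₂] (h : IsMetricNear G x)
    (h₁ : IsMetricNear G₁ x.1) (h₂ : IsMetricNear G₂ x.2)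
    (hG : ∀ᶠ y in 𝓝 x, G y = sumForm (G₁ y.1) (G₂ y.2)) (u v w : E₁ × E₂) :
    fderiv ℝ (christoffel G) x u v w
      = (fderiv ℝ (christoffel G₁) x.1 u.1 v.1 w.1, fderiv ℝ (christoffel G₂) x.2 u.2 v.2 w.2) := by
  rw [← fderiv_apply₂ (h.contDiffAt_christoffel.differentiableAt (by simp))]
  have h3 : (fun y => christoffel G y v w) =ᶠ[𝓝 x]
      fun y => (christoffel G₁ y.1 v.1 w.1, christoffel G₂ y.2 v.2 w.2) := by
    filter_upwards [h.eventually, continuousAt_fst.eventually h₁.eventually,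
      continuousAt_snd.eventually h₂.eventually, hG.eventually_nhds] with y a b c d
    exact christoffel_sumForm a b c d v w
  have d1 := ((((h₁.contDiffAt_christoffel.differentiableAt (by simp)).hasFDerivAt).comp x
    hasFDerivAt_fst).clm_apply (hasFDerivAt_const v.1 x)).clm_apply (hasFDerivAt_const w.1 x)
  have d2 := ((((h₂.contDiffAt_christoffel.differentiableAt (by simp)).hasFDerivAt).comp x
    hasFDerivAt_snd).clm_apply (hasFDerivAt_const v.2 x)).clm_apply (hasFDerivAt_const w.2 x)
  rw [h3.fderiv_eq]
  erw [(d1.prodMk d2).fderiv]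
  simp

theorem curvatureOperator_sumForm [CompleteSpace E₁] [CompleteSpace E₂] (h : IsMetricNear G x)
    (h₁ : IsMetricNear G₁ x.1) (h₂ : IsMetricNear G₂ x.2)
    (hG : ∀ᶠ y in 𝓝 x, G y = sumForm (G₁ y.1) (G₂ y.2)) (u v w : E₁ × E₂) :
    curvatureOperator G x u v w
      = (curvatureOperator G₁ x.1 u.1 v.1 w.1, curvatureOperator G₂ x.2 u.2 v.2 w.2) := by
  simp only [curvatureOperator_apply, fderiv_christoffel_sumForm h h₁ h₂ hG,
    christoffel_sumForm h h₁ h₂ hG]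
  rfl

end DirectSum

/-! ### Symmetry and additivity of the Ricci tensor -/

section Ricci

variable {E : Type*} [NormedAddCommGroup E] [NormedSpace ℝ E] [FiniteDimensional ℝ E]

/-- Endomorphisms adjoint to each other with respect to a nondegenerate form have equal traces. -/
theorem trace_eq_of_adjoint {g : E →L[ℝ] E →L[ℝ] ℝ} (hg : ∀ v, (∀ w, g v w = 0) → v = 0)
    {A B : E →ₗ[ℝ] E} (h : ∀ v w, g (A v) w = g v (B w)) :
    LinearMap.trace ℝ E A = LinearMap.trace ℝ E B := by
  let f : E →ₗ[ℝ] Module.Dual ℝ E := (ContinuousLinearMap.coeLM ℝ) ∘ₗ (g : E →ₗ[ℝ] E →L[ℝ] ℝ)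
  have hf : Function.Injective f := by
    rw [← LinearMap.ker_eq_bot, LinearMap.ker_eq_bot']
    exact fun v hv => hg v fun w => DFunLike.congr_fun hv w
  let e := f.linearEquivOfInjective hf Subspace.dual_finrank_eq.symm
  -- The form, viewed as an isomorphism onto the dual, conjugates A into the transpose of B.
  have h1 : e.conj A = Module.Dual.transpose (R := ℝ) B := by
    ext φ w
    obtain ⟨v, rfl⟩ := e.surjective φ
    simp only [LinearEquiv.conj_apply_apply, LinearEquiv.symm_apply_apply]
    exact h v w
  rw [← LinearMap.trace_conj' A e, h1, LinearMap.trace_transpose']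

/-- Pair symmetry says that v ↦ R(v, z)y and w ↦ R(w, y)z are adjoint, so their traces agree. -/
theorem IsCurvatureLike.ricciOf_symm {g : E →L[ℝ] E →L[ℝ] ℝ} {R : E →L[ℝ] E →L[ℝ] E →L[ℝ] E}
    (h : IsCurvatureLike g R) (hg : ∀ v, (∀ w, g v w = 0) → v = 0) (y z : E) :
    ricciOf R y z = ricciOf R z y := by
  rw [ricciOf_apply, ricciOf_apply]
  refine trace_eq_of_adjoint hg fun v w => ?_
  rw [h.symm]
  exact h.pair_symm w y v z

theorem ricciOf_prod {E' : Type*} [NormedAddCommGroup E'] [NormedSpace ℝ E']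
    [FiniteDimensional ℝ E'] {R₁ : E →L[ℝ] E →L[ℝ] E →L[ℝ] E}
    {R₂ : E' →L[ℝ] E' →L[ℝ] E' →L[ℝ] E'}
    {R : E × E' →L[ℝ] E × E' →L[ℝ] E × E' →L[ℝ] E × E'}
    (h : ∀ u v w, R u v w = (R₁ u.1 v.1 w.1, R₂ u.2 v.2 w.2)) (y z : E × E') :
    ricciOf R y z = ricciOf R₁ y.1 z.1 + ricciOf R₂ y.2 z.2 := by
  rw [ricciOf_apply, ricciOf_apply, ricciOf_apply, ← LinearMap.trace_prodMap']
  congr 1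
  exact LinearMap.ext fun u => h u z y

end Ricci

/-! ### Magnetic components of Weyl-type tensors -/

section WeylAlgebra

variable {E : Type*} [NormedAddCommGroup E] [NormedSpace ℝ E]

/-- A four-tensor with the symmetries of the Riemann and Weyl tensors (the Bianchi identity
excepted). -/
structure HasWeylSymmetries (T : E → E → E → E → ℝ) : Prop where
  add_left : ∀ a a' b c d, T (a + a') b c d = T a b c d + T a' b c d
  smul_left : ∀ (r : ℝ) a b c d, T (r • a) b c d = r * T a b c d
  skew : ∀ a b c d, T a b c d = -T b a c d
  pair_symm : ∀ a b c d, T a b c d = T c d a b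

namespace HasWeylSymmetries

variable {T : E → E → E → E → ℝ} (h : HasWeylSymmetries T)

include h

theorem skew_right (a b c d : E) : T a b c d = -T a b d c := by
  rw [h.pair_symm, h.skew, h.pair_symm d]

theorem add₂ (a b b' c d : E) : T a (b + b') c d = T a b c d + T a b' c d := by
  rw [h.skew, h.add_left, h.skew a b, h.skew a b']
  ring

theorem smul₂ (r : ℝ) (a b c d : E) : T a (r • b) c d = r * T a b c d := by
  rw [h.skew, h.smul_left, h.skew a b]
  ring

theorem add₃ (a b c c' d : E) : T a b (c + c') d = T a b c d + T a b c' d := by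
  rw [h.pair_symm, h.add_left, h.pair_symm a b c, h.pair_symm a b c']

theorem smul₃ (r : ℝ) (a b c d : E) : T a b (r • c) d = r * T a b c d := by
  rw [h.pair_symm, h.smul_left, h.pair_symm a b c]

theorem add₄ (a b c d d' : E) : T a b c (d + d') = T a b c d + T a b c d' := by
  rw [h.pair_symm, h.add₂, h.pair_symm a b c d, h.pair_symm a b c d']

theorem smul₄ (r : ℝ) (a b c d : E) : T a b c (r • d) = r * T a b c d := by
  rw [h.pair_symm, h.smul₂, h.pair_symm a b c d]

theorem self_left (a c d : E) : T a a c d = 0 := by linarith [h.skew a a c d]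

theorem self_right (a b c : E) : T a b c c = 0 := by linarith [h.skew_right a b c c]

/-- Invariance under the reflection in the hyperplane orthogonal to `u` means that the components
with exactly one entry `u` vanish. -/
theorem reflection_invariant_iff {g : E →L[ℝ] E →L[ℝ] ℝ} {u : E} (hu : g u u = -1) :
    (∀ a b c d, T a b c d = T (a + (2 * g u a) • u) (b + (2 * g u b) • u)
        (c + (2 * g u c) • u) (d + (2 * g u d) • u)) ↔
      ∀ x y z, g u x = 0 → g u y = 0 → g u z = 0 → T u x y z = 0 := by
  constructor
  · intro H x y z hx hy hz
    -- The reflection fixes x, y, z and sends u to u - 2u = -u, so the component equals its own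
    -- negative.
    have h1 := H u x y z
    simp only [hu, hx, hy, hz, mul_zero, zero_smul, add_zero] at h1
    rw [h.add_left, h.smul_left] at h1
    linarith
  · intro H a b c d
    -- Split v along u and its complement, with coefficient -g(u, v) because g(u, u) = -1; the
    -- reflection negates that coefficient only.
    have dec (v : E) : ∃ (r : ℝ) (x : E), g u x = 0 ∧ v = r • u + x ∧
        v + (2 * g u v) • u = (-r) • u + x := by
      refine ⟨-g u v, v + g u v • u, by simp [hu], by module, by module⟩
    obtain ⟨α, x, hx, ea, ea'⟩ := dec a
    obtain ⟨β, y, hy, eb, eb'⟩ := dec b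
    obtain ⟨γ, z, hz, ec, ec'⟩ := dec c
    obtain ⟨δ, w, hw, ed, ed'⟩ := dec d
    rw [ea', eb', ec', ed', ea, eb, ec, ed]
    have H2 (x y z) (hx : g u x = 0) (hy : g u y = 0) (hz : g u z = 0) : T x u y z = 0 := by
      rw [h.skew, H x y z hx hy hz, neg_zero]
    -- Of the sixteen terms, those with three or four entries u vanish by antisymmetry and those
    -- with one by H; those with none or two are unchanged.
    simp only [h.add_left, h.add₂, h.add₃, h.add₄, h.smul_left, h.smul₂, h.smul₃, h.smul₄,
      h.self_left, h.self_right, H _ _ _ hy hz hw, H2 _ _ _ hx hz hw,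
      h.pair_symm x y u w, H _ _ _ hw hx hy, h.pair_symm x y z u, H2 _ _ _ hz hx hy]
    ring

end HasWeylSymmetries

variable {g : E →L[ℝ] E →L[ℝ] ℝ} {R : E →L[ℝ] E →L[ℝ] E →L[ℝ] E}

theorem eq_zero_of_mem_span {k : ℕ} {m : Fin k → E} {f : E → ℝ}
    (hadd : ∀ x y, f (x + y) = f x + f y) (hsmul : ∀ (r : ℝ) x, f (r • x) = r * f x)
    (hf : ∀ i, f (m i) = 0) {x : E} (hx : x ∈ Submodule.span ℝ (Set.range m)) : f x = 0 := by
  induction hx using Submodule.span_induction with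
  | mem x hx => obtain ⟨i, rfl⟩ := hx; exact hf i
  | zero => simpa using hsmul 0 0
  | add x y _ _ h1 h2 => rw [hadd, h1, h2, add_zero]
  | smul r x _ h1 => rw [hsmul, h1, mul_zero]

theorem HasWeylSymmetries.eq_zero_of_frame {T : E → E → E → E → ℝ} (h : HasWeylSymmetries T)
    {u : E} {k : ℕ} {m : Fin k → E} (hT : ∀ i j l, T u (m i) (m j) (m l) = 0) {x y z : E}
    (hx : x ∈ Submodule.span ℝ (Set.range m)) (hy : y ∈ Submodule.span ℝ (Set.range m))
    (hz : z ∈ Submodule.span ℝ (Set.range m)) : T u x y z = 0 :=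
  eq_zero_of_mem_span (f := fun x => T u x y z) (fun _ _ => h.add₂ ..) (fun _ _ => h.smul₂ ..)
    (fun i => eq_zero_of_mem_span (f := fun y => T u (m i) y z) (fun _ _ => h.add₃ ..)
      (fun _ _ => h.smul₃ ..)
      (fun j => eq_zero_of_mem_span (fun _ _ => h.add₄ ..) (fun _ _ => h.smul₄ ..)
        (fun l => hT i j l) hz) hy) hx

theorem ricci_eigenvector_iff {B : E →ₗ[ℝ] E →ₗ[ℝ] ℝ} (hs : ∀ v w, g v w = g w v) {u : E}
    (hu : g u u = -1) :
    (u ≠ 0 ∧ ∃ r : ℝ, ∀ v, B v u = r * g v u) ↔ ∀ x, g u x = 0 → B x u = 0 := by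
  constructor
  · rintro ⟨-, r, hr⟩ x hx
    rw [hr, hs, hx, mul_zero]
  · intro H
    -- Evaluating at v = u forces the eigenvalue, since g(u, u) = -1.
    refine ⟨fun h0 => by simp [h0] at hu, -B u u, fun v => ?_⟩
    have h1 := H (v + g u v • u) (by simp [hu])
    simp only [map_add, map_smul, LinearMap.add_apply, LinearMap.smul_apply, smul_eq_mul] at h1
    rw [hs v u]
    linarith

variable [FiniteDimensional ℝ E]

/-- In dimension at most two the orthogonal complement of `u` is at most a line, on which the skew
curvature operator vanishes. -/
theorem apply_curvature_eq_zero_of_finrank_le (h : IsCurvatureLike g R)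
    (hn : Module.finrank ℝ E ≤ 2) {u y z : E} (x : E) (hu : g u u = -1) (hy : g u y = 0)
    (hz : g u z = 0) : g u (R y z x) = 0 := by
  let f : Module.Dual ℝ E := (g u : E →ₗ[ℝ] ℝ)
  have hf : f ≠ 0 := fun h0 => by
    have : f u = 0 := by rw [h0]; rfl
    have h1 : f u = -1 := hu
    linarith
  have h1 := Module.Dual.finrank_ker_add_one_of_ne_zero hf
  obtain ⟨e, he⟩ := (finrank_le_one_iff (K := ℝ) (V := LinearMap.ker f)).1 (by omega)
  obtain ⟨r, hr⟩ := he ⟨y, hy⟩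
  obtain ⟨s, hs⟩ := he ⟨z, hz⟩
  have hr' : y = r • (e : E) := (congrArg Subtype.val hr).symm
  have hs' : z = s • (e : E) := (congrArg Subtype.val hs).symm
  have h0 : g u (R (e : E) e x) = 0 := by
    have := congrArg (g u) (h.skew e e x)
    rw [map_neg] at this
    linarith
  rw [hr', hs']
  simp [h0]

/-- The correction terms are built from g and Ric in the pattern that has these symmetries;
exchanging the pairs also uses the symmetry of Ric. -/
theorem IsCurvatureLike.hasWeylSymmetries (h : IsCurvatureLike g R)
    (hg : ∀ v, (∀ w, g v w = 0) → v = 0) : HasWeylSymmetries (weylOf g R) where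
  add_left a a' b c d := by
    simp only [weylOf]
    split_ifs
    · simp
    · simp only [map_add, add_apply]
      ring
  smul_left r a b c d := by
    simp only [weylOf]
    split_ifs
    · simp
    · simp only [map_smul, smul_apply, smul_eq_mul]
      ring
  skew a b c d := by
    simp only [weylOf]
    split_ifs
    · simp
    · rw [h.skew_adjoint c d b a, h.symm d b, h.symm d a, h.symm c b, h.symm c a]
      ring
  pair_symm a b c d := by
    simp only [weylOf]
    split_ifs
    · rfl
    · rw [h.pair_symm a b c d, h.symm d b, h.symm c a, h.symm c b, h.symm d a,
        h.ricciOf_symm hg d b, h.ricciOf_symm hg c b, h.ricciOf_symm hg d a,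
        h.ricciOf_symm hg c a]
      ring

/-- Every term with a factor g(u, y) or g(u, z) drops out, including the whole scalar curvature
term, so no metric trace ever has to be computed. -/
theorem weylOf_of_orthogonal (hn : 2 < Module.finrank ℝ E) {u y z : E} (x : E) (hy : g u y = 0)
    (hz : g u z = 0) :
    weylOf g R u x y z = g u (R y z x) + 1 / ((Module.finrank ℝ E : ℝ) - 2) *
      (g x y * ricciOf R z u - g x z * ricciOf R y u) := by
  rw [weylOf, if_neg (by omega), hy, hz]
  ring

variable {E' : Type*} [NormedAddCommGroup E'] [NormedSpace ℝ E'] [FiniteDimensional ℝ E']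
  {g' : E' →L[ℝ] E' →L[ℝ] ℝ} {R' : E' →L[ℝ] E' →L[ℝ] E' →L[ℝ] E'}
  {S : E × E' →L[ℝ] E × E' →L[ℝ] E × E' →L[ℝ] E × E'}

/-- The magnetic components of the Weyl tensor of a direct sum vanish if and only if those of the
first summand do, and the vector is a Ricci eigenvector there. -/
theorem weylOf_sumForm_iff (h : IsCurvatureLike g R)
    (hS : ∀ u v w, S u v w = (R u.1 v.1 w.1, R' u.2 v.2 w.2))
    (hn : 2 < Module.finrank ℝ (E × E')) {u : E} (hu : g u u = -1) {e : E'} (he : g' e e ≠ 0) :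
    (∀ x y z : E × E', sumForm g g' (u, 0) x = 0 → sumForm g g' (u, 0) y = 0 →
        sumForm g g' (u, 0) z = 0 → weylOf (sumForm g g') S (u, 0) x y z = 0) ↔
      (∀ x, g u x = 0 → ricciOf R x u = 0) ∧
        ∀ x y z, g u x = 0 → g u y = 0 → g u z = 0 → weylOf g R u x y z = 0 := by
  have hlift (x : E × E') : sumForm g g' (u, 0) x = g u x.1 := by simp [sumForm_apply]
  have hric (x : E × E') : ricciOf S x (u, 0) = ricciOf R x.1 u := by
    rw [ricciOf_prod hS, map_zero, add_zero]
  have hR (x y z : E × E') : sumForm g g' (u, 0) (S y z x) = g u (R y.1 z.1 x.1) := by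
    rw [hlift, hS]
  have hpos : (0 : ℝ) < (Module.finrank ℝ (E × E') : ℝ) - 2 := by
    have : (2 : ℝ) < Module.finrank ℝ (E × E') := by exact_mod_cast hn
    linarith
  constructor
  · intro H
    have hr (x : E) (hx : g u x = 0) : ricciOf R x u = 0 := by
      -- With x = y = (0, e) the curvature term vanishes and only g'(e, e) Ric(x, u)/(n - 2)
      -- survives.
      have h1 := H (0, e) (0, e) (x, 0) (by simp [hlift]) (by simp [hlift]) (by simpa [hlift])
      rw [weylOf_of_orthogonal hn _ (by simp [hlift]) (by simpa [hlift]), hR, hric, hric] at h1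
      simp only [sumForm_apply, map_zero, zero_apply, zero_mul, sub_zero, zero_add, mul_eq_zero,
        he, false_or, add_zero] at h1
      rcases h1 with h1 | h1
      · exact absurd h1 (one_div_pos.2 hpos).ne'
      · exact h1
    refine ⟨hr, fun x y z hx hy hz => ?_⟩
    by_cases hd : Module.finrank ℝ E ≤ 2
    · rw [weylOf, if_pos hd]
    -- With the Ricci terms gone, both Weyl components equal g(u, R(y, z)x), so the different
    -- factors 1/(n - 2) do not matter.
    have h1 := H (x, 0) (y, 0) (z, 0) (by simpa [hlift]) (by simpa [hlift]) (by simpa [hlift])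
    rw [weylOf_of_orthogonal hn _ (by simpa [hlift]) (by simpa [hlift]), hR, hric, hric, hr z hz,
      hr y hy] at h1
    rw [weylOf_of_orthogonal (by omega) _ hy hz, hr z hz, hr y hy]
    simpa using h1
  · rintro ⟨hr, hw⟩ x y z hx hy hz
    rw [weylOf_of_orthogonal hn _ hy hz, hR, hric, hric]
    rw [hlift] at hx hy hz
    rw [hr _ hz, hr _ hy]
    suffices g u (R y.1 z.1 x.1) = 0 by simp [this]
    -- In dimension at most two the Weyl hypothesis is empty by convention, and the curvature term
    -- vanishes for another reason: the first components of y and z are proportional.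
    by_cases hd : Module.finrank ℝ E ≤ 2
    · exact apply_curvature_eq_zero_of_finrank_le h hd _ hu hy hz
    · have h1 := hw _ _ _ hx hy hz
      rw [weylOf_of_orthogonal (by omega) _ hy hz, hr _ hz, hr _ hy] at h1
      simpa using h1

/-- An orthonormal frame completing a unit timelike vector spans its orthogonal complement. -/
theorem mem_span_of_frame {u : E} {k : ℕ} {m : Fin k → E} (hk : k + 1 = Module.finrank ℝ E)
    (hu : g u u = -1) (hum : ∀ i, g u (m i) = 0)
    (hm : ∀ i j, g (m i) (m j) = if i = j then 1 else 0) {x : E} (hx : g u x = 0) :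
    x ∈ Submodule.span ℝ (Set.range m) := by
  -- Pairing a relation with u and with each m j isolates its coefficients; k + 1 = dim then gives a
  -- basis.
  have hli : LinearIndependent ℝ (Fin.cons u m : Fin (k + 1) → E) := by
    rw [Fintype.linearIndependent_iff]
    intro c hc
    rw [Fin.sum_univ_succ] at hc
    simp only [Fin.cons_zero, Fin.cons_succ] at hc
    have h0 : c 0 = 0 := by
      have := congrArg (g u) hc
      simpa [hu, hum] using this
    have h1 (j : Fin k) : c j.succ = 0 := by
      have := congrArg (fun v => g v (m j)) hc
      simpa [hum, hm] using this
    exact fun i => Fin.cases h0 h1 i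
  have hspan := hli.span_eq_top_of_card_eq_finrank' (by simpa using hk)
  rw [Fin.range_cons] at hspan
  obtain ⟨r, z, hz, rfl⟩ := Submodule.mem_span_insert.1 (hspan ▸ Submodule.mem_top : x ∈ _)
  have hz0 : g u z = 0 := by
    have hle : Submodule.span ℝ (Set.range m) ≤ LinearMap.ker (g u : E →ₗ[ℝ] ℝ) := by
      rw [Submodule.span_le]
      rintro _ ⟨i, rfl⟩
      exact hum i
    exact hle hz
  have hr : r = 0 := by simpa [hu, hz0] using hx
  simpa [hr] using hz

end WeylAlgebra

/-- Guarantees that `inverse` is the true raising of indices and not its default value 0. -/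
theorem isInvertible_of_nondegenerate {E : Type*} [NormedAddCommGroup E] [NormedSpace ℝ E]
    [FiniteDimensional ℝ E] {b : E →L[ℝ] E →L[ℝ] ℝ} (hb : ∀ v, (∀ w, b v w = 0) → v = 0) :
    b.IsInvertible := by
  have hf : Function.Injective (b : E →ₗ[ℝ] E →L[ℝ] ℝ) := by
    rw [← LinearMap.ker_eq_bot, LinearMap.ker_eq_bot']
    exact fun v hv => hb v fun w => DFunLike.congr_fun hv w
  have hd : Module.finrank ℝ E = Module.finrank ℝ (E →L[ℝ] ℝ) := by
    rw [← (LinearMap.toContinuousLinearMap : (E →ₗ[ℝ] ℝ) ≃ₗ[ℝ] (E →L[ℝ] ℝ)).finrank_eq]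
    exact Subspace.dual_finrank_eq.symm
  exact ⟨(LinearEquiv.ofInjectiveOfFinrankEq _ hf hd).toContinuousLinearEquiv, rfl⟩

/-! ### From coordinates to manifolds -/

namespace Metric

section Basic

variable {E : Type*} [NormedAddCommGroup E] [NormedSpace ℝ E]
  {H : Type*} [TopologicalSpace H] {I : ModelWithCorners ℝ E H} [I.Boundaryless]
  {M : Type*} [TopologicalSpace M] [ChartedSpace H M] [IsManifold I ∞ M]

/-- The tangent space at p is identified with E by the chart at p itself, so the derivative of the
inverse chart there is the identity. -/
theorem inChart_self (g : Metric I M) (p : M) :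
    inChart g.val p (extChartAt I p p) = g.val p := by
  have e1 : IsManifold I 1 M := IsManifold.of_le (n := ∞) (by simp)
  have hA := mfderivWithin_range_extChartAt_symm (I := I) (x := p)
  rw [ModelWithCorners.range_eq_univ, mfderivWithin_univ] at hA
  have hq : (extChartAt I p).symm (extChartAt I p p) = p := extChartAt_to_inv p
  have key : ∀ (q : M) (a b a' b' : E), q = p → a = a' → b = b' →
      (g.val q a b : ℝ) = g.val p a' b' := by
    rintro q a b _ _ rfl rfl rfl
    rfl
  refine ContinuousLinearMap.ext fun v => ContinuousLinearMap.ext fun w => ?_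
  exact key _ _ _ _ _ hq (DFunLike.congr_fun hA v) (DFunLike.congr_fun hA w)

theorem isRicciEigenvector_iff (g : Metric I M) (p : M) {u : TangentSpace I p}
    (hu : g.val p u u = -1) :
    g.IsRicciEigenvector p u ↔ ∀ x, g.val p u x = 0 → g.ricci p x u = 0 :=
  ricci_eigenvector_iff (E := E) (g := g.val p) (B := g.ricci p) (g.symm p) hu

variable [FiniteDimensional ℝ E]

/-- The inverse chart has invertible derivative on its open domain, so nondegeneracy survives the
pull-back. -/
theorem isMetricNear_inChart (g : Metric I M) (p : M) {y : E} (hy : y ∈ (extChartAt I p).target) :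
    IsMetricNear (inChart g.val p) y := by
  have e1 : IsManifold I 1 M := IsManifold.of_le (n := ∞) (by simp)
  have ht := (isOpen_extChartAt_target (I := I) p).mem_nhds hy
  refine ⟨?_, ?_, ?_⟩
  · filter_upwards [ht] with z hz
    exact (g.smooth p).contDiffAt ((isOpen_extChartAt_target (I := I) p).mem_nhds hz)
  · filter_upwards with z v w using g.symm _ _ _
  · filter_upwards [ht] with z hz
    refine isInvertible_of_nondegenerate fun v hv => ?_
    have hA := isInvertible_mfderivWithin_extChartAt_symm hz
    rw [ModelWithCorners.range_eq_univ, mfderivWithin_univ] at hA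
    obtain ⟨A, hA⟩ := hA
    have h1 : mfderiv 𝓘(ℝ, E) I (extChartAt I p).symm z v = 0 := by
      refine g.nondegenerate _ _ fun w => ?_
      obtain ⟨w, rfl⟩ := A.surjective w
      have := hv w
      rw [← ContinuousLinearEquiv.coe_coe, hA]
      exact this
    rw [← hA] at h1
    exact A.map_eq_zero_iff.1 h1

theorem isCurvatureLike (g : Metric I M) (p : M) :
    IsCurvatureLike (E := E) (g.val p) (g.curvature p) := by
  have := FiniteDimensional.complete ℝ E
  have h := (g.isMetricNear_inChart p (mem_extChartAt_target p)).isCurvatureLike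
  rwa [inChart_self] at h

theorem hasWeylSymmetries (g : Metric I M) (p : M) : HasWeylSymmetries (E := E) (g.weyl p) :=
  (g.isCurvatureLike p).hasWeylSymmetries (g.nondegenerate p)

theorem ricci_symm (g : Metric I M) (p : M) (v w : TangentSpace I p) :
    g.ricci p v w = g.ricci p w v :=
  (g.isCurvatureLike p).ricciOf_symm (g.nondegenerate p) v w

/-- Pure electricity is the vanishing of the magnetic components `C(u, x, y, z)`. -/
theorem isPE_iff (g : Metric I M) (p : M) {u : TangentSpace I p} (hu : g.val p u u = -1) :
    g.IsPE p u ↔ ∀ x y z, g.val p u x = 0 → g.val p u y = 0 → g.val p u z = 0 →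
      g.weyl p u x y z = 0 := by
  refine Iff.trans ?_ ((g.hasWeylSymmetries p).reflection_invariant_iff (E := E) hu)
  refine forall₄_congr fun a b c d => ?_
  have h (s t : ℝ) : s = 1 / 2 * (s + t) ↔ s = t := by
    constructor <;> intro h <;> linarith
  exact h _ _

/-- Both conditions are linear in each vector orthogonal to u, and the frame spans that orthogonal
complement. -/
theorem isRicciEigenvector_and_isPE_iff (g : Metric I M) (p : M) {u : TangentSpace I p} {k : ℕ}
    {m : Fin k → TangentSpace I p} (hm : g.IsFrame p u m) :
    (g.IsRicciEigenvector p u ∧ g.IsPE p u) ↔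
      (∀ A, g.ricci p u (m A) = 0) ∧ ∀ A B C, g.weyl p u (m A) (m B) (m C) = 0 := by
  obtain ⟨hk, hu, hum, hmm⟩ := hm
  rw [isRicciEigenvector_iff g p hu, isPE_iff g p hu]
  have hspan {x : TangentSpace I p} (hx : g.val p u x = 0) :=
    mem_span_of_frame (E := E) (g := g.val p) hk hu hum hmm hx
  constructor
  · rintro ⟨h1, h2⟩
    exact ⟨fun A => (g.ricci_symm p _ _).trans (h1 _ (hum A)),
      fun A B C => h2 _ _ _ (hum A) (hum B) (hum C)⟩
  · rintro ⟨h1, h2⟩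
    refine ⟨fun x hx => ?_, fun x y z hx hy hz => ?_⟩
    · rw [ricci_symm]
      exact eq_zero_of_mem_span (E := E) (f := g.ricci p u) (map_add _) (map_smul _) h1 (hspan hx)
    · exact (g.hasWeylSymmetries p).eq_zero_of_frame (E := E) h2 (hspan hx) (hspan hy) (hspan hz)

end Basic

/-! ### Product manifolds -/

section Product

variable {E₁ : Type*} [NormedAddCommGroup E₁] [NormedSpace ℝ E₁]
  {H₁ : Type*} [TopologicalSpace H₁] {I₁ : ModelWithCorners ℝ E₁ H₁} [I₁.Boundaryless]
  {M₁ : Type*} [TopologicalSpace M₁] [ChartedSpace H₁ M₁] [IsManifold I₁ ∞ M₁]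
  {E₂ : Type*} [NormedAddCommGroup E₂] [NormedSpace ℝ E₂]
  {H₂ : Type*} [TopologicalSpace H₂] {I₂ : ModelWithCorners ℝ E₂ H₂} [I₂.Boundaryless]
  {M₂ : Type*} [TopologicalSpace M₂] [ChartedSpace H₂ M₂] [IsManifold I₂ ∞ M₂]
  (g₁ : Metric I₁ M₁) (g₂ : Metric I₂ M₂) (p : M₁ × M₂)

variable {p} {U : TangentSpace I₁ p.1}

theorem prod_val_liftLeft (x : E₁ × E₂) :
    (g₁.prod g₂).val p (liftLeft p U) x = g₁.val p.1 U x.1 := by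
  have h : g₁.val p.1 U x.1 + g₂.val p.2 0 x.2 = g₁.val p.1 U x.1 := by
    rw [map_zero]
    exact add_zero _
  exact h

theorem prod_val_liftLeft_self (hU : g₁.IsUnitTimelike p.1 U) :
    (g₁.prod g₂).val p (liftLeft p U) (liftLeft p U) = -1 :=
  (prod_val_liftLeft g₁ g₂ _).trans hU

variable [FiniteDimensional ℝ E₁] [FiniteDimensional ℝ E₂]

/-- The product chart splits the metric on an open neighbourhood of the point, which is all that the
coordinate computation needs. -/
theorem curvature_prod (p : M₁ × M₂) (u v w : E₁ × E₂) :
    ((g₁.prod g₂).curvature p u v w : E₁ × E₂)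
      = (g₁.curvature p.1 u.1 v.1 w.1, g₂.curvature p.2 u.2 v.2 w.2) := by
  have := FiniteDimensional.complete ℝ E₁
  have := FiniteDimensional.complete ℝ E₂
  have hx : extChartAt (I₁.prod I₂) p p = (extChartAt I₁ p.1 p.1, extChartAt I₂ p.2 p.2) := by
    rw [extChartAt_prod]
    rfl
  have h := (g₁.prod g₂).isMetricNear_inChart p (mem_extChartAt_target p)
  have hG := (isOpen_extChartAt_target (I := I₁.prod I₂) p).mem_nhds (mem_extChartAt_target p)
  rw [hx] at h hG
  have := curvatureOperator_sumForm h (g₁.isMetricNear_inChart p.1 (mem_extChartAt_target p.1))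
    (g₂.isMetricNear_inChart p.2 (mem_extChartAt_target p.2))
    (Filter.mem_of_superset hG fun y hy => inChart_prodVal g₁ g₂ p y hy) u v w
  rw [← hx] at this
  exact this

theorem prod_ricci_liftLeft (x : E₁ × E₂) :
    (g₁.prod g₂).ricci p x (liftLeft p U) = g₁.ricci p.1 x.1 U := by
  have h := ricciOf_prod (curvature_prod g₁ g₂ p) x (U, 0)
  rw [map_zero, add_zero] at h
  exact h

theorem isPE_prod_iff (hn₂ : 1 ≤ Module.finrank ℝ E₂)
    (hn : 4 ≤ Module.finrank ℝ E₁ + Module.finrank ℝ E₂) (hg₂ : g₂.IsRiemannian)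
    (hU : g₁.IsUnitTimelike p.1 U) :
    (g₁.prod g₂).IsPE p (liftLeft p U) ↔ g₁.IsRicciEigenvector p.1 U ∧ g₁.IsPE p.1 U := by
  rw [isPE_iff _ p (prod_val_liftLeft_self g₁ g₂ hU), isRicciEigenvector_iff g₁ p.1 hU,
    isPE_iff g₁ p.1 hU]
  -- The second factor has positive dimension and a definite metric, which supplies e with g₂(e, e)
  -- ≠ 0.
  have : Nontrivial E₂ := Module.nontrivial_of_finrank_pos (R := ℝ) (by omega)
  obtain ⟨e, he⟩ := exists_ne (0 : E₂)
  exact weylOf_sumForm_iff (E := E₁) (E' := E₂) (g' := g₂.val p.2) (g₁.isCurvatureLike p.1) (curvature_prod g₁ g₂ p)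
    (by rw [Module.finrank_prod]; omega) hU (hg₂ p.2 e he).ne'

/-- Orthogonality to the lift of U and the Ricci component against it both depend on the first
component alone. -/
theorem isRicciEigenvector_prod (hU : g₁.IsUnitTimelike p.1 U)
    (h : g₁.IsRicciEigenvector p.1 U) :
    (g₁.prod g₂).IsRicciEigenvector p (liftLeft p U) := by
  rw [isRicciEigenvector_iff _ p (prod_val_liftLeft_self g₁ g₂ hU)]
  rw [isRicciEigenvector_iff g₁ p.1 hU] at h
  intro x hx
  exact (prod_ricci_liftLeft g₁ g₂ x).trans <| h _ ((prod_val_liftLeft g₁ g₂ x).symm.trans hx)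

end Product

end Metric

end PseudoRiemannian

end

/-! ### The main theorem -/

open PseudoRiemannian in
theorem mainTheorem9
    {E₁ : Type*} [NormedAddCommGroup E₁] [NormedSpace ℝ E₁] [FiniteDimensional ℝ E₁]
    {H₁ : Type*} [TopologicalSpace H₁] (I₁ : ModelWithCorners ℝ E₁ H₁) [I₁.Boundaryless]
    {M₁ : Type*} [TopologicalSpace M₁] [ChartedSpace H₁ M₁] [IsManifold I₁ ∞ M₁]
    {E₂ : Type*} [NormedAddCommGroup E₂] [NormedSpace ℝ E₂] [FiniteDimensional ℝ E₂]
    {H₂ : Type*} [TopologicalSpace H₂] (I₂ : ModelWithCorners ℝ E₂ H₂) [I₂.Boundaryless]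
    {M₂ : Type*} [TopologicalSpace M₂] [ChartedSpace H₂ M₂] [IsManifold I₂ ∞ M₂] [Nonempty M₂]
    (hn₂ : 1 ≤ Module.finrank ℝ E₂)
    (hn : 4 ≤ Module.finrank ℝ E₁ + Module.finrank ℝ E₂)
    (g₁ : Metric I₁ M₁) (hg₁ : g₁.IsLorentzian)
    (g₂ : Metric I₂ M₂) (hg₂ : g₂.IsRiemannian) :
    -- at each point, for each unit timelike vector living in the Lorentzian factor
    (∀ (p : M₁ × M₂) (U : TangentSpace I₁ p.1), g₁.IsUnitTimelike p.1 U →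
      ((g₁.prod g₂).IsPE p (Metric.liftLeft p U) ↔
        g₁.IsRicciEigenvector p.1 U ∧ g₁.IsPE p.1 U) ∧
      (∀ (k : ℕ) (m : Fin k → TangentSpace I₁ p.1), g₁.IsFrame p.1 U m →
        ((g₁.IsRicciEigenvector p.1 U ∧ g₁.IsPE p.1 U) ↔
          (∀ A, g₁.ricci p.1 U (m A) = 0) ∧
          (∀ A B C, g₁.weyl p.1 U (m A) (m B) (m C) = 0))) ∧
      ((g₁.prod g₂).IsPE p (Metric.liftLeft p U) →
        (g₁.prod g₂).IsRicciEigenvector p (Metric.liftLeft p U) ∧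
        ∀ (k : ℕ) (m : Fin k → TangentSpace (I₁.prod I₂) p),
          (g₁.prod g₂).IsFrame p (Metric.liftLeft p U) m →
          ∀ i, (g₁.prod g₂).ricci p (Metric.liftLeft p U) (m i) = 0)) ∧
    -- for the whole spacetime, with respect to a unit timelike field living in that factor
    (∀ U : ∀ x : M₁, TangentSpace I₁ x, (∀ x, g₁.IsUnitTimelike x (U x)) →
      ((∀ p : M₁ × M₂, (g₁.prod g₂).IsPE p (Metric.liftLeft p (U p.1))) ↔
        (∀ x, g₁.IsRicciEigenvector x (U x)) ∧ (∀ x, g₁.IsPE x (U x))) ∧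
      ((∀ p : M₁ × M₂, (g₁.prod g₂).IsPE p (Metric.liftLeft p (U p.1))) →
        ∀ p : M₁ × M₂, (g₁.prod g₂).IsRicciEigenvector p (Metric.liftLeft p (U p.1)))) := by
  have key (p : M₁ × M₂) (U : TangentSpace I₁ p.1) (hU : g₁.IsUnitTimelike p.1 U) :
      (g₁.prod g₂).IsPE p (Metric.liftLeft p U) ↔
        g₁.IsRicciEigenvector p.1 U ∧ g₁.IsPE p.1 U :=
    Metric.isPE_prod_iff g₁ g₂ hn₂ hn hg₂ hU
  have hric (p : M₁ × M₂) (U : TangentSpace I₁ p.1) (hU : g₁.IsUnitTimelike p.1 U)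
      (h : (g₁.prod g₂).IsPE p (Metric.liftLeft p U)) :
      (g₁.prod g₂).IsRicciEigenvector p (Metric.liftLeft p U) :=
    Metric.isRicciEigenvector_prod g₁ g₂ hU ((key p U hU).1 h).1
  refine ⟨fun p U hU => ⟨key p U hU, fun k m hm => g₁.isRicciEigenvector_and_isPE_iff p.1 hm,
    fun h => ⟨hric p U hU h, fun k m hm i => ?_⟩⟩, fun U hU => ⟨⟨fun h => ?_, fun h p => ?_⟩,
      fun h p => hric p (U p.1) (hU p.1) (h p)⟩⟩
  · rw [Metric.ricci_symm]
    exact (Metric.isRicciEigenvector_iff _ p (Metric.prod_val_liftLeft_self g₁ g₂ hU)).1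
      (hric p U hU h) _ (hm.2.2.1 i)
  -- A point q of the second factor is needed to reach every x in the first through (x, q).
  · obtain ⟨q⟩ := ‹Nonempty M₂›
    have h' (x : M₁) := (key (x, q) (U x) (hU x)).1 (h (x, q))
    exact ⟨fun x => (h' x).1, fun x => (h' x).2⟩
  · exact (key p (U p.1) (hU p.1)).2 ⟨h.1 p.1, h.2 p.1⟩
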